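/- **Setting (bilateral trade).** Let $\Theta_S,\Theta_B\subseteq[0,\infty)$ be Borel sets of types. A seller $S$ has a private cost $\theta_S\in\Theta_S$ and a buyer $B$ has a private value $\theta_B\in\Theta_B$, drawn independently from $\mathcal D_S\in\Delta(\Theta_S)$ and $\mathcal D_B\in\Delta(\Theta_B)$, where $\Delta(X)$ denotes the set of probability distributions on $X$. If $S$ posts a price $a\ge 0$, the utilities are $u_S=(a-\theta_S)\mathbf 1\{\theta_B\ge a\}$ and $u_B=(\theta_B-a)\mathbf 1\{\theta_B\ge a\}$. Throughout, a *state* is a pair $(\mathcal D_S,\mathcal D_B)$ such that $\mathcal D_B$ has finite mean (so that the efficient welfare is finite). **Protocols.** A distribution $M\in\Delta(\Delta(X))$ is a *refinement* of $\mathcal D\in\Delta(X)$ if drawing $\mathcal D'\sim M$ and then $x\sim\mathcal D'$ gives $x\sim\mathcal D$. A protocol consists of a price $a^*(\theta_S;\mathcal D_B)$, posted by $S$ when communication is over, and of messages indexed by $t=1,2,\dots$, where $t$ stands for the $t$-th to last round: for odd $t$ (the buyer speaks) a refinement $m^t_B(\mathcal D_S,\mathcal D_B)$ of $\mathcal D_B$,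 for even $t$ (the seller speaks) a refinement $m^t_S(\mathcal D_S,\mathcal D_B)$ of $\mathcal D_S$. The payoffs of $i\in\{S,B\}$ with $t$ rounds are $\pi^0_i(\mathcal D_S,\mathcal D_B)=\mathbb E_{\theta_S\sim\mathcal D_S}\mathbb E_{\theta_B\sim\mathcal D_B}[u_i(a^*(\theta_S;\mathcal D_B),\theta_S,\theta_B)]$, and, for $t\ge1$, $\pi^t_i(\mathcal D_S,\mathcal D_B)=\mathbb E_{\mathcal D_B'\sim m^t_B(\mathcal D_S,\mathcal D_B)}[\pi^{t-1}_i(\mathcal D_S,\mathcal D_B')]$ if $t$ is odd and $\pi^t_i(\mathcal D_S,\mathcal D_B)=\mathbb E_{\mathcal D_S'\sim m^t_S(\mathcal D_S,\mathcal D_B)}[\pi^{t-1}_i(\mathcal D_S',\mathcal D_B)]$ if $t$ is even. **Equilibrium (ties broken in favour of the other agent).** A refinement by the speaker of round $t$ is *voluntary* at a state if it gives each $i\in\{S,B\}$ an expected value of $\pi_i^{t-1}$ at least equal to the value of $\pi_i^{t-1}$ at that state. The protocol is an equilibrium if at every state: for every $\theta_S \in \Theta_S$ the price $a^*(\theta_S;\mathcal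 D_B)$ maximizes $\mathbb E_{\theta_B\sim\mathcal D_B}[u_S]$ over all prices $a\ge0$ and, among the maximizers, maximizes $\mathbb E_{\theta_B\sim\mathcal D_B}[u_B]$; and in every round $t\ge1$ the expectations of $\pi^{t-1}_S$ and $\pi^{t-1}_B$ under every refinement by the speaker exist, and the speaker's message is a voluntary refinement which, among all voluntary refinements, maximizes lexicographically first the speaker's and then the other agent's expected value of $\pi^{t-1}$. **Message complexity.** In an equilibrium $\pi_i^t$ is nondecreasing in $t$; let $\pi_i^\infty=\lim_{t\to\infty}\pi_i^t$, and let $\mathbf C(\mathcal D_S,\mathcal D_B)$ be the least $t\in\mathbb N\cup\{\infty\}$ (where $0\in\mathbb N$) with $\pi_S^t+\pi_B^t=\pi_S^\infty+\pi_B^\infty$ at $(\mathcal D_S,\mathcal D_B)$. **Theorem.** For every equilibrium protocol and every state $(\mathcal D_S,\mathcal D_B)$: if $\mathbf C(\mathcal D_S,\mathcal D_B)=t<\infty$, then the equilibrium allocation after $t$ rounds is efficient, i.e. $$\pi^t_S(\mathcal D_S,\mathcal D_B)+\pi^t_B(\mathcal D_S,\mathcal D_B)=W^*(\mathcal D_S,\mathcal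 D_B):=\mathbb E_{\theta_S\sim\mathcal D_S}\mathbb E_{\theta_B\sim\mathcal D_B}\big[(\theta_B-\theta_S)^+\big].$$ -/

import Mathlib

open MeasureTheory Filter Topology

noncomputable section

namespace BilateralTrade

/-- The two players: Sally (the seller) and Bob (the buyer). -/
inductive Agent
  | S
  | B


open Classical in
/-- Utilities of the base game: Sally posts the price `a`, and Bob buys iff `a ≤ θB`. -/
def utility (i : Agent) (a θS θB : ℝ) : ℝ :=
  match i with
  | .S => if a ≤ θB then a - θS else 0
  | .B => if a ≤ θB then θB - a else 0

/-- `Δ(Θ)`: the probability distributions on the type space `Θ ⊆ ℝ`. -/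
abbrev Distr (Θ : Set ℝ) : Type := ProbabilityMeasure Θ

/-- The distribution has finite mean. -/
def FiniteMean {Θ : Set ℝ} (D : Distr Θ) : Prop :=
  Integrable (fun θ : Θ => (θ : ℝ)) (D : Measure Θ)

/-- `M ∈ Δ(Δ(Θ))` is an information refinement of `D`: sampling `D' ∼ M` and then `θ ∼ D'`
yields the distribution `D`. -/
def Refines {Θ : Set ℝ} (M : ProbabilityMeasure (Distr Θ)) (D : Distr Θ) : Prop :=
  Measure.bind (M : Measure (Distr Θ)) (fun D' => (D' : Measure Θ)) = (D : Measure Θ)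

/-- `x` maximizes `(f, g)` lexicographically over `s`: it maximizes `f` over `s`, and it maximizes
`g` among all maximizers of `f` over `s`. -/
def IsLexMax {α : Type*} (f g : α → ℝ) (s : Set α) (x : α) : Prop :=
  x ∈ s ∧ (∀ y ∈ s, f y ≤ f x) ∧ ∀ y ∈ s, f y = f x → g y ≤ g x

/-- An alternating information refinement protocol of arbitrary length.  The index `t` of a message
means "`t`-th to last": at odd `t` Bob speaks (`msgB t`), at even `t ≥ 2` Sally speaks (`msgS t`);
the remaining values of `msgB` and `msgS` are not used.  When communication is over, Sally with
type `θS` and belief `DB` about Bob posts `price θS DB`. -/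
structure Protocol (ΘS ΘB : Set ℝ) where
  price : ΘS → Distr ΘB → ℝ
  msgB : ℕ → Distr ΘS → Distr ΘB → ProbabilityMeasure (Distr ΘB)
  msgS : ℕ → Distr ΘS → Distr ΘB → ProbabilityMeasure (Distr ΘS)
  msgB_refines : ∀ t DS DB, Refines (msgB t DS DB) DB
  msgS_refines : ∀ t DS DB, Refines (msgS t DS DB) DS

variable {ΘS ΘB : Set ℝ}

/-- Expected utility of agent `i` if Sally has type `θS`, Bob's type is drawn from `DB`, and the
price is `a`. -/
def expUtility (i : Agent) (a : ℝ) (θS : ΘS) (DB : Distr ΘB) : ℝ :=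
  ∫ θB : ΘB, utility i a θS θB ∂(DB : Measure ΘB)

namespace Protocol

/-- `π_i^t(DS, DB)`: expected payoff of agent `i` when the last `t` rounds of the protocol are
played starting from the information `(DS, DB)`. -/
def payoff (P : Protocol ΘS ΘB) : ℕ → Agent → Distr ΘS → Distr ΘB → ℝ
  | 0, i, DS, DB => ∫ θS : ΘS, expUtility i (P.price θS DB) θS DB ∂(DS : Measure ΘS)
  | t + 1, i, DS, DB =>
    if Odd (t + 1) then
      ∫ DB' : Distr ΘB, P.payoff t i DS DB' ∂(P.msgB (t + 1) DS DB : Measure (Distr ΘB))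
    else
      ∫ DS' : Distr ΘS, P.payoff t i DS' DB ∂(P.msgS (t + 1) DS DB : Measure (Distr ΘS))

/-- `E_{DB' ∼ M} [π_i^t(DS, DB')]`. -/
def expB (P : Protocol ΘS ΘB) (t : ℕ) (i : Agent) (DS : Distr ΘS)
    (M : ProbabilityMeasure (Distr ΘB)) : ℝ :=
  ∫ DB' : Distr ΘB, P.payoff t i DS DB' ∂(M : Measure (Distr ΘB))

/-- `E_{DS' ∼ M} [π_i^t(DS', DB)]`. -/
def expS (P : Protocol ΘS ΘB) (t : ℕ) (i : Agent) (DB : Distr ΘB)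
    (M : ProbabilityMeasure (Distr ΘS)) : ℝ :=
  ∫ DS' : Distr ΘS, P.payoff t i DS' DB ∂(M : Measure (Distr ΘS))

/-- Bob's voluntary refinements in round `t + 1`: those which hurt neither player compared with
skipping the round. -/
def VRB (P : Protocol ΘS ΘB) (t : ℕ) (DS : Distr ΘS) (DB : Distr ΘB) :
    Set (ProbabilityMeasure (Distr ΘB)) :=
  {M | Refines M DB ∧ ∀ i, P.payoff t i DS DB ≤ P.expB t i DS M}

/-- Sally's voluntary refinements in round `t + 1`. -/
def VRS (P : Protocol ΘS ΘB) (t : ℕ) (DS : Distr ΘS) (DB : Distr ΘB) :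
    Set (ProbabilityMeasure (Distr ΘS)) :=
  {M | Refines M DS ∧ ∀ i, P.payoff t i DS DB ≤ P.expS t i DB M}

/-- The protocol is an equilibrium in which each agent breaks ties in favour of the other one.
The conditions are imposed at all states in which Bob's value has finite mean (the states with a
finite efficient welfare):
* Sally's price maximizes her own expected utility and, among such prices, Bob's;
* in every round, the expected continuation payoffs after any refinement by the speaker exist;
* in every round, the speaker's message is voluntary and, among the voluntary refinements, it
  maximizes lexicographically the speaker's and then the listener's expected payoff. -/
structure IsEquilibrium (P : Protocol ΘS ΘB) : Prop where
  price_opt : ∀ (θS : ΘS) (DB : Distr ΘB), FiniteMean DB →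
    IsLexMax (fun a => expUtility .S a θS DB) (fun a => expUtility .B a θS DB)
      {a : ℝ | 0 ≤ a} (P.price θS DB)
  integrableB : ∀ t : ℕ, Odd (t + 1) → ∀ (DS : Distr ΘS) (DB : Distr ΘB), FiniteMean DB →
    ∀ M : ProbabilityMeasure (Distr ΘB), Refines M DB → ∀ i,
      Integrable (fun DB' => P.payoff t i DS DB') (M : Measure (Distr ΘB))
  integrableS : ∀ t : ℕ, Even (t + 1) → ∀ (DS : Distr ΘS) (DB : Distr ΘB), FiniteMean DB →
    ∀ M : ProbabilityMeasure (Distr ΘS), Refines M DS → ∀ i,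
      Integrable (fun DS' => P.payoff t i DS' DB) (M : Measure (Distr ΘS))
  msgB_opt : ∀ t : ℕ, Odd (t + 1) → ∀ (DS : Distr ΘS) (DB : Distr ΘB), FiniteMean DB →
    IsLexMax (P.expB t .B DS) (P.expB t .S DS) (P.VRB t DS DB) (P.msgB (t + 1) DS DB)
  msgS_opt : ∀ t : ℕ, Even (t + 1) → ∀ (DS : Distr ΘS) (DB : Distr ΘB), FiniteMean DB →
    IsLexMax (P.expS t .S DB) (P.expS t .B DB) (P.VRS t DS DB) (P.msgS (t + 1) DS DB)

/-- `π_i^t(DS, DB)` for `t ∈ ℕ ∪ {∞}`, where `π_i^∞` is the limit of `π_i^t` as `t → ∞`.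
In an equilibrium the sequence is monotone and bounded at every state in which Bob's value has
finite mean, so that the limit exists there. -/
def payoffE (P : Protocol ΘS ΘB) (t : ℕ∞) (i : Agent) (DS : Distr ΘS) (DB : Distr ΘB) : ℝ :=
  match t with
  | (n : ℕ) => P.payoff n i DS DB
  | ⊤ => limUnder atTop (fun n : ℕ => P.payoff n i DS DB)

/-- The message complexity `C(DS, DB) ∈ ℕ ∪ {∞}`. -/
def messageComplexity (P : Protocol ΘS ΘB) (DS : Distr ΘS) (DB : Distr ΘB) : ℕ∞ :=
  sInf {t : ℕ∞ | P.payoffE t .S DS DB + P.payoffE t .B DS DB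
    = P.payoffE ⊤ .S DS DB + P.payoffE ⊤ .B DS DB}

end Protocol

/-- `W*(DS, DB)`: the expected welfare under efficient trade. -/
def efficientWelfare (DS : Distr ΘS) (DB : Distr ΘB) : ℝ :=
  ∫ θS : ΘS, ∫ θB : ΘB, max ((θB : ℝ) - (θS : ℝ)) 0 ∂(DB : Measure ΘB) ∂(DS : Measure ΘS)

end BilateralTrade

end

/-!
No refinement can weakly improve on an equilibrium message for both players unless it yields the
same payoffs. Hence, if more than `t + 1` rounds are of no use at a state, then more than `t` rounds
are of no use at almost every state reached by the first message, and efficiency reduces to states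
at which communication is of no use at all.

At such a state even full revelation by Sally is of no use, so that for almost every cost `c` of
hers, one message of Bob is of no use when `c` is commonly known. Then almost no type of Bob lies
strictly between `c` and the price, which is to say that trade is efficient: otherwise Bob would
gain by a suitable split of his types into two parts.
-/

open ProbabilityTheory
open scoped NNReal

section Integral

variable {α : Type*} [MeasurableSpace α] {μ : Measure α} {f g h : α → ℝ}

lemma integral_add_le_of_add_le (hf : ∀ x, 0 ≤ f x) (hg : ∀ x, 0 ≤ g x)
    (hfg : ∀ x, f x + g x ≤ h x) (hh : Integrable h μ) :
    ∫ x, f x ∂μ + ∫ x, g x ∂μ ≤ ∫ x, h x ∂μ := by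
  have hfh (x) : f x ≤ h x := (le_add_of_nonneg_right (hg x)).trans (hfg x)
  have hgh (x) : g x ≤ h x := (le_add_of_nonneg_left (hf x)).trans (hfg x)
  by_cases hfi : Integrable f μ
  · by_cases hgi : Integrable g μ
    · rw [← integral_add hfi hgi]
      exact integral_mono (hfi.add hgi) hh hfg
    · rw [integral_undef hgi, add_zero]
      exact integral_mono hfi hh hfh
  · rw [integral_undef hfi, zero_add]
    exact integral_mono_of_nonneg (ae_of_all _ hg) hh (ae_of_all _ hgh)

lemma ae_eq_of_integral_eq_of_nonneg (hf : ∀ x, 0 ≤ f x) (hfg : ∀ x, f x ≤ g x)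
    (hg : Integrable g μ) (h : ∫ x, f x ∂μ = ∫ x, g x ∂μ) : f =ᵐ[μ] g := by
  by_cases hfi : Integrable f μ
  · exact (integral_eq_iff_of_ae_le hfi hg (ae_of_all _ hfg)).1 h
  · rw [integral_undef hfi] at h
    have hg0 : g =ᵐ[μ] 0 :=
      (integral_eq_zero_iff_of_nonneg (fun x => (hf x).trans (hfg x)) hg).1 h.symm
    filter_upwards [hg0] with x hx
    exact le_antisymm (hfg x) (hx.trans_le (hf x))

lemma integral_smul_dirac_of_integrable {c : ℝ≥0} {x : α}
    (hf : Integrable f (c • Measure.dirac x)) :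
    ∫ y, f y ∂(c • Measure.dirac x) = c * f x := by
  rw [integral_smul_nnreal_measure, NNReal.smul_def, smul_eq_mul]
  rcases eq_or_ne c 0 with rfl | hc
  · simp
  have hf' : AEStronglyMeasurable f (Measure.dirac x) :=
    hf.aestronglyMeasurable.mono_ac (Measure.absolutelyContinuous_smul (ENNReal.coe_ne_zero.2 hc))
  have hx : f x = hf'.mk f x := by
    by_contra hne
    exact one_ne_zero ((Measure.dirac_apply_of_mem (a := x) hne).symm.trans (ae_iff.1 hf'.ae_eq_mk))
  rw [integral_congr_ae hf'.ae_eq_mk, integral_dirac' _ _ hf'.stronglyMeasurable_mk, hx]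

end Integral

namespace BilateralTrade

variable {Θ ΘS ΘB : Set ℝ}

section Refinement

/-- The kernel sampling a type from a distribution. It turns the `Measure.bind` of `Refines` into a
composition of a measure with a kernel. -/
noncomputable def distrKernel (Θ : Set ℝ) : Kernel (Distr Θ) Θ :=
  ⟨fun D => (D : Measure Θ), measurable_subtype_coe⟩

instance : IsMarkovKernel (distrKernel Θ) :=
  ⟨fun D => inferInstanceAs (IsProbabilityMeasure (D : Measure Θ))⟩

namespace Refines

variable {M : ProbabilityMeasure (Distr Θ)} {D : Distr Θ}

lemma comp_distrKernel (h : Refines M D) :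
    (distrKernel Θ ∘ₖ Kernel.const Unit (M : Measure (Distr Θ))) () = D :=
  (Measure.comp_eq_comp_const_apply (κ := distrKernel Θ)).symm.trans h

lemma ae_finiteMean (h : Refines M D) (hD : FiniteMean D) :
    ∀ᵐ D' : Distr Θ ∂(M : Measure (Distr Θ)), FiniteMean D' :=
  (h.comp_distrKernel ▸ hD :
    Integrable _ ((distrKernel Θ ∘ₖ Kernel.const Unit (M : Measure (Distr Θ))) ())).ae_of_comp

lemma integrable_integral (h : Refines M D) {f : Θ → ℝ} (hf : Integrable f (D : Measure Θ)) :
    Integrable (fun D' : Distr Θ => ∫ x, f x ∂(D' : Measure Θ)) (M : Measure (Distr Θ)) := by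
  rw [← h.comp_distrKernel] at hf
  exact hf.integral_comp

lemma integral_integral (h : Refines M D) {f : Θ → ℝ} (hf : Integrable f (D : Measure Θ)) :
    ∫ D' : Distr Θ, ∫ x, f x ∂(D' : Measure Θ) ∂(M : Measure (Distr Θ))
      = ∫ x, f x ∂(D : Measure Θ) := by
  rw [← h.comp_distrKernel] at hf ⊢
  exact (Kernel.integral_comp hf).symm

end Refines

lemma exists_refines_of_smul_add_smul_eq {D D₁ D₂ : Distr Θ} {a b : ℝ≥0}
    (h : a • (D₁ : Measure Θ) + b • (D₂ : Measure Θ) = D) {u : Distr Θ → ℝ}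
    (hu : ∀ M : ProbabilityMeasure (Distr Θ), Refines M D → Integrable u (M : Measure (Distr Θ))) :
    ∃ M : ProbabilityMeasure (Distr Θ), Refines M D ∧
      ∫ D', u D' ∂(M : Measure (Distr Θ)) = a * u D₁ + b * u D₂ := by
  set M : Measure (Distr Θ) := a • Measure.dirac D₁ + b • Measure.dirac D₂ with hM
  have hbind : M.bind (distrKernel Θ) = D := by
    rw [← h, hM, Measure.comp_add, Measure.bind_smul, Measure.bind_smul,
      Measure.dirac_bind (distrKernel Θ).measurable, Measure.dirac_bind (distrKernel Θ).measurable]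
    rfl
  have hprob : IsProbabilityMeasure M := ⟨by
    simpa [hM] using congrArg (· Set.univ) h⟩
  have hint := hu ⟨M, hprob⟩ hbind
  obtain ⟨h₁, h₂⟩ := integrable_add_measure.1 hint
  refine ⟨⟨M, hprob⟩, hbind, ?_⟩
  exact (integral_add_measure h₁ h₂).trans
    (congrArg₂ _ (integral_smul_dirac_of_integrable h₁) (integral_smul_dirac_of_integrable h₂))

/-- The distribution of a commonly known type. -/
noncomputable def pointMass (c : Θ) : Distr Θ := ⟨Measure.dirac c, inferInstance⟩

lemma measurable_pointMass : Measurable (pointMass : Θ → Distr Θ) :=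
  Measurable.subtype_mk Measure.measurable_dirac

/-- The refinement that reveals the type. -/
noncomputable def fullRevelation (D : Distr Θ) : ProbabilityMeasure (Distr Θ) :=
  D.map measurable_pointMass.aemeasurable

lemma refines_fullRevelation (D : Distr Θ) : Refines (fullRevelation D) D := by
  change ((D : Measure Θ).map pointMass).bind (distrKernel Θ) = D
  rw [Measure.bind, Measure.map_map (distrKernel Θ).measurable measurable_pointMass]
  exact Measure.bind_dirac

end Refinement

section Market

variable {μ : Measure Θ} {c a p q : ℝ}

/-- The types that buy at the price `a`. -/
def tail (Θ : Set ℝ) (a : ℝ) : Set Θ := {v | a ≤ v}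

/-- The expected profit of a seller with cost `c` at the price `a`, for a population `μ` of buyers
of arbitrary mass. -/
noncomputable def profit (μ : Measure Θ) (c a : ℝ) : ℝ := (a - c) * μ.real (tail Θ a)

/-- The expected consumer surplus of the population `μ` at the price `a`. At `a = c` it is the
efficient gain from trade with a seller of cost `c`. -/
noncomputable def surplus (μ : Measure Θ) (a : ℝ) : ℝ := ∫ v : Θ, max ((v : ℝ) - a) 0 ∂μ

/-- The price `p` is optimal for a seller with cost `c`, ties being broken in favour of the
buyers. -/
def IsOptimalPrice (μ : Measure Θ) (c p : ℝ) : Prop :=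
  IsLexMax (profit μ c) (surplus μ) {a | 0 ≤ a} p

@[measurability]
lemma measurableSet_tail : MeasurableSet (tail Θ a) :=
  measurableSet_le measurable_const measurable_subtype_coe

lemma utility_seller (v : Θ) :
    utility .S a c v = (tail Θ a).indicator (fun _ => a - c) v := by
  simp only [utility, tail, Set.indicator, Set.mem_ofPred_eq]
  congr

lemma utility_buyer (v : ℝ) : utility .B a c v = max (v - a) 0 := by
  unfold utility
  split_ifs with h
  · rw [max_eq_left (sub_nonneg.2 h)]
  · rw [max_eq_right (sub_nonpos.2 (not_le.1 h).le)]

lemma expUtility_seller (c : ΘS) (D : Distr ΘB) :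
    expUtility .S a c D = profit (D : Measure ΘB) c a := by
  simp only [expUtility, profit, utility_seller]
  rw [integral_indicator_const _ measurableSet_tail, smul_eq_mul, mul_comm]

lemma expUtility_buyer (c : ΘS) (D : Distr ΘB) :
    expUtility .B a c D = surplus (D : Measure ΘB) a := by
  simp only [expUtility, surplus, utility_buyer]

lemma integrable_max_sub [IsFiniteMeasure μ] (hμ : Integrable (fun v : Θ => (v : ℝ)) μ) (a : ℝ) :
    Integrable (fun v : Θ => max ((v : ℝ) - a) 0) μ :=
  (hμ.sub (integrable_const a)).pos_part

lemma integrable_utility [IsFiniteMeasure μ] (hμ : Integrable (fun v : Θ => (v : ℝ)) μ)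
    (i : Agent) (a c : ℝ) : Integrable (fun v : Θ => utility i a c v) μ := by
  cases i
  · simp only [utility_seller]
    exact (integrable_const _).indicator measurableSet_tail
  · simp only [utility_buyer]
    exact integrable_max_sub hμ a

lemma surplus_nonneg : 0 ≤ surplus μ a := integral_nonneg fun _ => le_max_right _ _

lemma profit_smul (r : ℝ≥0) : profit (r • μ) c a = r * profit μ c a := by
  simp only [profit, measureReal_nnreal_smul_apply]
  ring

lemma surplus_smul (r : ℝ≥0) : surplus (r • μ) a = r * surplus μ a :=
  integral_smul_nnreal_measure _ r

lemma isOptimalPrice_smul_iff {r : ℝ≥0} (hr : r ≠ 0) :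
    IsOptimalPrice (r • μ) c p ↔ IsOptimalPrice μ c p := by
  have hr' : (0 : ℝ) < r := by positivity
  simp only [IsOptimalPrice, IsLexMax, profit_smul, surplus_smul, mul_le_mul_iff_right₀ hr',
    mul_right_inj' hr'.ne']

lemma profit_add {ν : Measure Θ} [IsFiniteMeasure μ] [IsFiniteMeasure ν] :
    profit (μ + ν) c a = profit μ c a + profit ν c a := by
  rw [profit, measureReal_add_apply, mul_add, profit, profit]

lemma surplus_add {ν : Measure Θ} [IsFiniteMeasure μ] [IsFiniteMeasure ν]
    (hμ : Integrable (fun v : Θ => (v : ℝ)) μ) (hν : Integrable (fun v : Θ => (v : ℝ)) ν) :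
    surplus (μ + ν) a = surplus μ a + surplus ν a :=
  integral_add_measure (integrable_max_sub hμ a) (integrable_max_sub hν a)

lemma surplus_restrict_tail [IsFiniteMeasure μ] (hμ : Integrable (fun v : Θ => (v : ℝ)) μ)
    (hqp : q ≤ p) :
    surplus (μ.restrict (tail Θ p)) q = surplus μ p + (p - q) * μ.real (tail Θ p) := by
  have hp : ∫ v in tail Θ p, max ((v : ℝ) - p) 0 ∂μ = surplus μ p :=
    setIntegral_eq_integral_of_forall_compl_eq_zero fun v hv =>
      max_eq_right (sub_nonpos.2 (not_le.1 hv).le)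
  have hv : ∀ v ∈ tail Θ p, max ((v : ℝ) - q) 0 = max ((v : ℝ) - p) 0 + (p - q) := by
    intro v (hv : p ≤ v)
    rw [max_eq_left (sub_nonneg.2 (hqp.trans hv)), max_eq_left (sub_nonneg.2 hv)]
    ring
  rw [surplus, setIntegral_congr_fun measurableSet_tail hv,
    integral_add (integrable_max_sub hμ p).integrableOn (integrable_const _), hp,
    setIntegral_const, smul_eq_mul, mul_comm]

lemma profit_add_surplus [IsFiniteMeasure μ] (hμ : Integrable (fun v : Θ => (v : ℝ)) μ) :
    profit μ c a + surplus μ a = ∫ v in tail Θ a, ((v : ℝ) - c) ∂μ := by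
  have hsurplus : surplus μ a = ∫ v in tail Θ a, ((v : ℝ) - a) ∂μ := by
    rw [surplus, ← setIntegral_eq_integral_of_forall_compl_eq_zero (s := tail Θ a)
      fun v hv => max_eq_right (sub_nonpos.2 (not_le.1 hv).le)]
    exact setIntegral_congr_fun measurableSet_tail fun v hv => max_eq_left (sub_nonneg.2 hv)
  have hprofit : profit μ c a = ∫ _ in tail Θ a, (a - c) ∂μ := by
    rw [setIntegral_const, smul_eq_mul, mul_comm, profit]
  have hi : Integrable (fun v : Θ => (v : ℝ) - a) μ := hμ.sub (integrable_const a)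
  rw [hsurplus, hprofit, ← integral_add (integrable_const _) hi.integrableOn]
  simp only [sub_add_sub_cancel']

lemma profit_add_surplus_le [IsFiniteMeasure μ] (hμ : Integrable (fun v : Θ => (v : ℝ)) μ) :
    profit μ c a + surplus μ a ≤ surplus μ c := by
  rw [profit_add_surplus hμ]
  calc ∫ v in tail Θ a, ((v : ℝ) - c) ∂μ ≤ ∫ v in tail Θ a, max ((v : ℝ) - c) 0 ∂μ :=
        integral_mono (hμ.sub (integrable_const c)).integrableOn
          (integrable_max_sub hμ c).integrableOn fun v => le_max_left _ _
    _ ≤ surplus μ c := setIntegral_le_integral (integrable_max_sub hμ c)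
        (ae_of_all _ fun v => le_max_right _ _)

lemma ae_le_or_le_of_measure_eq_zero
    (h : ∀ s, c < s → μ (tail Θ s \ tail Θ p) = 0) : ∀ᵐ v : Θ ∂μ, (v : ℝ) ≤ c ∨ p ≤ v := by
  have hrat : ∀ᵐ v : Θ ∂μ, ∀ q : ℚ, c < q → v ∉ tail Θ q \ tail Θ p := by
    simp only [ae_all_iff]
    exact fun q hq => measure_eq_zero_iff_ae_notMem.1 (h q hq)
  filter_upwards [hrat] with v hv
  by_contra! hvcp
  obtain ⟨q, hcq, hqv⟩ := exists_rat_btwn hvcp.1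
  exact hv q hcq ⟨hqv.le, not_le.2 hvcp.2⟩

namespace IsOptimalPrice

lemma profit_nonneg (hc : 0 ≤ c) (h : IsOptimalPrice μ c p) : 0 ≤ profit μ c p := by
  simpa [profit] using h.2.1 c hc

lemma profit_restrict_le [IsFiniteMeasure μ] (hc : 0 ≤ c) (h : IsOptimalPrice μ c p) (A : Set Θ)
    (ha : 0 ≤ a) : profit (μ.restrict A) c a ≤ profit μ c p := by
  rcases le_total c a with hca | hac
  · refine le_trans ?_ (h.2.1 a ha)
    exact mul_le_mul_of_nonneg_left
      (ENNReal.toReal_mono (measure_ne_top _ _) (Measure.restrict_apply_le _ _)) (sub_nonneg.2 hca)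
  · exact (mul_nonpos_of_nonpos_of_nonneg (sub_nonpos.2 hac) measureReal_nonneg).trans
      (h.profit_nonneg hc)

lemma surplus_le_of_restrict_tail [IsFiniteMeasure μ] (hμ : Integrable (fun v : Θ => (v : ℝ)) μ)
    (hc : 0 ≤ c) (h : IsOptimalPrice μ c p) (hq : IsOptimalPrice (μ.restrict (tail Θ p)) c q) :
    surplus μ p ≤ surplus (μ.restrict (tail Θ p)) q := by
  have hprofit : profit (μ.restrict (tail Θ p)) c p = profit μ c p := by
    simp only [profit, measureReal_restrict_apply measurableSet_tail, Set.inter_self]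
  calc surplus μ p = surplus (μ.restrict (tail Θ p)) p := by
        rw [surplus_restrict_tail hμ le_rfl, sub_self, zero_mul, add_zero]
    _ ≤ surplus (μ.restrict (tail Θ p)) q :=
        hq.2.2 p h.1 ((hq.2.1 p h.1).antisymm
          ((h.profit_restrict_le hc _ hq.1).trans hprofit.ge))

lemma profit_add_surplus_eq [IsFiniteMeasure μ] (hμ : Integrable (fun v : Θ => (v : ℝ)) μ)
    (hc : 0 ≤ c) (h : IsOptimalPrice μ c p) (hgap : ∀ᵐ v : Θ ∂μ, (v : ℝ) ≤ c ∨ p ≤ v) :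
    profit μ c p + surplus μ p = surplus μ c := by
  rw [profit_add_surplus hμ, surplus, ← integral_indicator measurableSet_tail]
  refine integral_congr_ae ?_
  have hloss : p < c → ∀ᵐ v : Θ ∂μ, v ∉ tail Θ p := fun hpc => by
    refine measure_eq_zero_iff_ae_notMem.1 ((measureReal_eq_zero_iff (by finiteness)).1 ?_)
    exact (nonpos_of_mul_nonneg_right (h.profit_nonneg hc) (sub_neg.2 hpc)).antisymm
      measureReal_nonneg
  filter_upwards [hgap, eventually_imp_distrib_left.2 hloss] with v hv hvp
  by_cases hpv : v ∈ tail Θ p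
  · rw [Set.indicator_of_mem hpv, max_eq_left]
    exact sub_nonneg.2 ((not_lt.1 fun hpc => hvp hpc hpv).trans hpv)
  · rw [Set.indicator_of_notMem hpv, max_eq_right]
    exact sub_nonpos.2 (hv.resolve_right hpv)

lemma lt_of_dilute_tail [IsFiniteMeasure μ] {ε : ℝ≥0} {s : ℝ} (hc : 0 ≤ c) (hcs : c ≤ s)
    (h : IsOptimalPrice μ c p) (hε : ε * profit μ c p < (s - c) * μ.real (tail Θ s \ tail Θ p))
    (hq : IsOptimalPrice (ε • μ.restrict (tail Θ p) + μ.restrict (tail Θ p)ᶜ) c q) : q < p := by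
  by_contra! hpq
  have hempty : tail Θ q ∩ (tail Θ p)ᶜ = ∅ :=
    Set.disjoint_iff_inter_eq_empty.1
      (Set.disjoint_compl_right_iff_subset.2 fun v hv => hpq.trans hv)
  have hhigh : profit (μ.restrict (tail Θ p)ᶜ) c q = 0 := by
    rw [profit, measureReal_restrict_apply measurableSet_tail, hempty, measureReal_empty, mul_zero]
  have hlow : profit (μ.restrict (tail Θ p)ᶜ) c s = (s - c) * μ.real (tail Θ s \ tail Θ p) := by
    rw [profit, measureReal_restrict_apply measurableSet_tail, Set.sdiff_eq]
  have hs : 0 ≤ profit (μ.restrict (tail Θ p)) c s :=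
    mul_nonneg (sub_nonneg.2 hcs) measureReal_nonneg
  have hopt := hq.2.1 s (hc.trans hcs)
  simp only [profit_add, profit_smul, hhigh, hlow] at hopt
  have hle := mul_le_mul_of_nonneg_left (h.profit_restrict_le hc (tail Θ p) hq.1) ε.coe_nonneg
  have hεs := mul_nonneg ε.coe_nonneg hs
  linarith

lemma surplus_lt_of_split [IsFiniteMeasure μ] (hμ : Integrable (fun v : Θ => (v : ℝ)) μ)
    (hc : 0 ≤ c) (h : IsOptimalPrice μ c p) (hA : 0 < μ.real (tail Θ p)) {ε r : ℝ≥0}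
    (hε : ε ≠ 0) (hr : r ≠ 0) (hεr : ε + r = 1) {q₁ q₂ : ℝ} (hq₁ : q₁ < p)
    (hq₂ : IsOptimalPrice (r • μ.restrict (tail Θ p)) c q₂) :
    surplus μ p < surplus (ε • μ.restrict (tail Θ p) + μ.restrict (tail Θ p)ᶜ) q₁
      + surplus (r • μ.restrict (tail Θ p)) q₂ := by
  have hε' : (0 : ℝ) < ε := by positivity
  have hεr' : (ε : ℝ) + r = 1 := by exact_mod_cast hεr
  have hdiscount : 0 < ε * ((p - q₁) * μ.real (tail Θ p)) :=
    mul_pos hε' (mul_pos (sub_pos.2 hq₁) hA)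
  have hrest : r * surplus μ p ≤ r * surplus (μ.restrict (tail Θ p)) q₂ :=
    mul_le_mul_of_nonneg_left
      (h.surplus_le_of_restrict_tail hμ hc ((isOptimalPrice_smul_iff hr).1 hq₂)) r.coe_nonneg
  have hlow : 0 ≤ surplus (μ.restrict (tail Θ p)ᶜ) q₁ := surplus_nonneg
  rw [surplus_add (hμ.restrict.smul_measure_nnreal) hμ.restrict, surplus_smul, surplus_smul,
    surplus_restrict_tail hμ hq₁.le]
  calc surplus μ p = (ε + r) * surplus μ p := by rw [hεr', one_mul]
    _ < _ := by linarith

end IsOptimalPrice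

lemma exists_smul_eq_of_ne_zero (μ : Measure Θ) [IsFiniteMeasure μ] (hμ : μ ≠ 0) :
    ∃ (r : ℝ≥0) (D : Distr Θ), r ≠ 0 ∧ r • (D : Measure Θ) = μ := by
  have hne : Nonempty Θ := not_isEmpty_iff.1 fun _ => hμ μ.eq_zero_of_isEmpty
  let ν : FiniteMeasure Θ := ⟨μ, inferInstance⟩
  refine ⟨ν.mass, ν.normalize, ?_, ?_⟩
  · exact ν.mass_nonzero_iff.2 fun h => hμ (congrArg (fun ρ : FiniteMeasure Θ => (ρ : Measure Θ)) h)
  · exact (congrArg (fun ρ : FiniteMeasure Θ => (ρ : Measure Θ)) ν.self_eq_mass_smul_normalize).symm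

section Split

variable {price : Distr Θ → ℝ} {D : Distr Θ}

lemma exists_optimalPrice_of_part
    (hprice : ∀ D : Distr Θ, FiniteMean D → IsOptimalPrice (D : Measure Θ) c (price D))
    [IsFiniteMeasure μ] (hμ : Integrable (fun v : Θ => (v : ℝ)) μ) (h0 : μ ≠ 0) :
    ∃ (r : ℝ≥0) (D : Distr Θ), r • (D : Measure Θ) = μ ∧ IsOptimalPrice μ c (price D) ∧
      r * surplus (D : Measure Θ) (price D) = surplus μ (price D) := by
  obtain ⟨r, D, hr, rfl⟩ := exists_smul_eq_of_ne_zero μ h0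
  have hD : FiniteMean D := (integrable_smul_measure (by simpa using hr) (by simp)).1 hμ
  exact ⟨r, D, rfl, (isOptimalPrice_smul_iff hr).2 (hprice D hD), (surplus_smul r).symm⟩

lemma exists_refines_of_add_eq
    (hprice : ∀ D : Distr Θ, FiniteMean D → IsOptimalPrice (D : Measure Θ) c (price D))
    (hD : FiniteMean D)
    (hint : ∀ M : ProbabilityMeasure (Distr Θ), Refines M D →
      Integrable (fun D' : Distr Θ => surplus (D' : Measure Θ) (price D')) (M : Measure (Distr Θ)))
    {μ₁ μ₂ : Measure Θ} [IsFiniteMeasure μ₁] [IsFiniteMeasure μ₂] (h₁ : μ₁ ≠ 0) (h₂ : μ₂ ≠ 0)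
    (h : μ₁ + μ₂ = D) :
    ∃ M : ProbabilityMeasure (Distr Θ), Refines M D ∧
      ∃ p q, IsOptimalPrice μ₁ c p ∧ IsOptimalPrice μ₂ c q ∧
        ∫ D' : Distr Θ, surplus (D' : Measure Θ) (price D') ∂(M : Measure (Distr Θ))
          = surplus μ₁ p + surplus μ₂ q := by
  rw [FiniteMean, ← h] at hD
  obtain ⟨hi₁, hi₂⟩ := integrable_add_measure.1 hD
  obtain ⟨a, D₁, ha, hp, hap⟩ := exists_optimalPrice_of_part hprice hi₁ h₁
  obtain ⟨b, D₂, hb, hq, hbq⟩ := exists_optimalPrice_of_part hprice hi₂ h₂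
  have hD₁₂ : a • (D₁ : Measure Θ) + b • (D₂ : Measure Θ) = D := by rw [ha, hb, h]
  obtain ⟨M, hM, hMint⟩ := exists_refines_of_smul_add_smul_eq hD₁₂ hint
  exact ⟨M, hM, _, _, hp, hq, by rw [hMint, hap, hbq]⟩

lemma exists_nnreal_add_eq_one_mul_lt {δ R : ℝ} (hδ : 0 < δ) (hR : 0 < R) :
    ∃ ε r : ℝ≥0, ε ≠ 0 ∧ r ≠ 0 ∧ ε + r = 1 ∧ ε * R < δ := by
  lift δ to ℝ≥0 using hδ.le
  lift R to ℝ≥0 using hR.le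
  norm_cast at hδ hR
  refine ⟨δ / (δ + R), R / (δ + R), by positivity, by positivity, ?_, ?_⟩
  · rw [← add_div, div_self (by positivity)]
  · norm_cast
    rw [div_mul_eq_mul_div, div_lt_iff₀ (by positivity)]
    exact mul_lt_mul_of_pos_left (lt_add_of_pos_left R hδ) hδ

-- Pool a fraction `ε` of the buyers above `p` with all buyers below `p`. For small `ε` the latter
-- matter more to the seller, who lowers her price for this pool. The remaining buyers above `p` do
-- not lose, since `p` stays optimal for them.
lemma exists_refines_surplus_lt (hc : 0 ≤ c)
    (hprice : ∀ D : Distr Θ, FiniteMean D → IsOptimalPrice (D : Measure Θ) c (price D))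
    (hD : FiniteMean D)
    (hint : ∀ M : ProbabilityMeasure (Distr Θ), Refines M D →
      Integrable (fun D' : Distr Θ => surplus (D' : Measure Θ) (price D')) (M : Measure (Distr Θ)))
    {s : ℝ} (hcs : c < s) (hs : (D : Measure Θ) (tail Θ s \ tail Θ (price D)) ≠ 0) :
    ∃ M : ProbabilityMeasure (Distr Θ), Refines M D ∧ surplus (D : Measure Θ) (price D)
      < ∫ D' : Distr Θ, surplus (D' : Measure Θ) (price D') ∂(M : Measure (Distr Θ)) := by
  set p := price D
  set A := tail Θ p
  set μ : Measure Θ := (D : Measure Θ)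
  have hp : IsOptimalPrice μ c p := hprice D hD
  have hgain : 0 < (s - c) * μ.real (tail Θ s \ A) :=
    mul_pos (sub_pos.2 hcs) (ENNReal.toReal_pos hs (measure_ne_top _ _))
  have hprofit : 0 < profit μ c p :=
    calc 0 < (s - c) * μ.real (tail Θ s \ A) := hgain
      _ ≤ (s - c) * μ.real (tail Θ s) :=
        mul_le_mul_of_nonneg_left (measureReal_mono Set.sdiff_subset) (sub_nonneg.2 hcs.le)
      _ ≤ profit μ c p := hp.2.1 s (hc.trans hcs.le)
  have hA : 0 < μ.real A := measureReal_nonneg.lt_of_ne' (right_ne_zero_of_mul hprofit.ne')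
  obtain ⟨ε, r, hε, hr, hεr, hlt⟩ := exists_nnreal_add_eq_one_mul_lt hgain hprofit
  have hμA : μ.restrict A ≠ 0 := fun h => hA.ne' (by
    rw [measureReal_def, Measure.restrict_eq_zero.1 h, ENNReal.toReal_zero])
  have hsum : (ε • μ.restrict A + μ.restrict Aᶜ) + r • μ.restrict A = μ := by
    rw [add_right_comm, ← add_smul, hεr, one_smul, Measure.restrict_add_restrict_compl
      measurableSet_tail]
  have hlow : ε • μ.restrict A + μ.restrict Aᶜ ≠ 0 := fun h =>
    smul_ne_zero hε hμA (Measure.nonpos_iff_eq_zero'.1 ((Measure.le_add_right le_rfl).trans h.le))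
  obtain ⟨M, hM, q₁, q₂, hq₁, hq₂, hMint⟩ :=
    exists_refines_of_add_eq hprice hD hint hlow (smul_ne_zero hr hμA) hsum
  refine ⟨M, hM, hMint ▸ hp.surplus_lt_of_split hD hc hA hε hr hεr ?_ hq₂⟩
  exact hp.lt_of_dilute_tail hc hcs.le hlt hq₁

lemma profit_add_surplus_eq_of_forall_refines_le (hc : 0 ≤ c)
    (hprice : ∀ D : Distr Θ, FiniteMean D → IsOptimalPrice (D : Measure Θ) c (price D))
    (hD : FiniteMean D)
    (hint : ∀ M : ProbabilityMeasure (Distr Θ), Refines M D →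
      Integrable (fun D' : Distr Θ => surplus (D' : Measure Θ) (price D')) (M : Measure (Distr Θ)))
    (hmax : ∀ M : ProbabilityMeasure (Distr Θ), Refines M D →
      ∫ D' : Distr Θ, surplus (D' : Measure Θ) (price D') ∂(M : Measure (Distr Θ))
        ≤ surplus (D : Measure Θ) (price D)) :
    profit (D : Measure Θ) c (price D) + surplus (D : Measure Θ) (price D)
      = surplus (D : Measure Θ) c := by
  refine (hprice D hD).profit_add_surplus_eq hD hc (ae_le_or_le_of_measure_eq_zero fun s hcs => ?_)
  by_contra hs
  obtain ⟨M, hM, hlt⟩ := exists_refines_surplus_lt hc hprice hD hint hcs hs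
  exact hlt.not_ge (hmax M hM)

end Split

end Market

section Welfare

lemma integrable_gain (hS0 : ∀ θ ∈ ΘS, 0 ≤ θ) (DS : Distr ΘS) {DB : Distr ΘB}
    (hDB : FiniteMean DB) :
    Integrable (fun p : ΘS × ΘB => max ((p.2 : ℝ) - p.1) 0)
      ((DS : Measure ΘS).prod (DB : Measure ΘB)) := by
  refine Integrable.mono' (Integrable.comp_snd (Integrable.abs hDB) (DS : Measure ΘS))
    (by fun_prop) (ae_of_all _ fun p => ?_)
  rw [Real.norm_of_nonneg (le_max_right _ _)]
  exact max_le ((sub_le_self _ (hS0 _ p.1.2)).trans (le_abs_self _)) (abs_nonneg _)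

lemma integrable_surplus (hS0 : ∀ θ ∈ ΘS, 0 ≤ θ) (DS : Distr ΘS) {DB : Distr ΘB}
    (hDB : FiniteMean DB) :
    Integrable (fun c : ΘS => surplus (DB : Measure ΘB) c) (DS : Measure ΘS) :=
  (integrable_gain hS0 DS hDB).integral_prod_left

lemma integrable_integral_gain (hS0 : ∀ θ ∈ ΘS, 0 ≤ θ) (DS : Distr ΘS) {DB : Distr ΘB}
    (hDB : FiniteMean DB) :
    Integrable (fun v : ΘB => ∫ c : ΘS, max ((v : ℝ) - c) 0 ∂(DS : Measure ΘS))
      (DB : Measure ΘB) :=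
  (integrable_gain hS0 DS hDB).integral_prod_right

lemma efficientWelfare_swap (hS0 : ∀ θ ∈ ΘS, 0 ≤ θ) (DS : Distr ΘS) {DB : Distr ΘB}
    (hDB : FiniteMean DB) :
    efficientWelfare DS DB
      = ∫ v : ΘB, ∫ c : ΘS, max ((v : ℝ) - c) 0 ∂(DS : Measure ΘS) ∂(DB : Measure ΘB) :=
  integral_integral_swap (f := fun (c : ΘS) (v : ΘB) => max ((v : ℝ) - c) 0)
    (integrable_gain hS0 DS hDB)

namespace Refines

variable {DS : Distr ΘS} {DB : Distr ΘB}

lemma integrable_efficientWelfare_seller {M : ProbabilityMeasure (Distr ΘS)} (h : Refines M DS)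
    (hS0 : ∀ θ ∈ ΘS, 0 ≤ θ) (hDB : FiniteMean DB) :
    Integrable (fun DS' => efficientWelfare DS' DB) (M : Measure (Distr ΘS)) :=
  h.integrable_integral (integrable_surplus hS0 DS hDB)

lemma integral_efficientWelfare_seller {M : ProbabilityMeasure (Distr ΘS)} (h : Refines M DS)
    (hS0 : ∀ θ ∈ ΘS, 0 ≤ θ) (hDB : FiniteMean DB) :
    ∫ DS', efficientWelfare DS' DB ∂(M : Measure (Distr ΘS)) = efficientWelfare DS DB :=
  h.integral_integral (integrable_surplus hS0 DS hDB)

variable {M : ProbabilityMeasure (Distr ΘB)}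

lemma ae_efficientWelfare_swap (h : Refines M DB) (hS0 : ∀ θ ∈ ΘS, 0 ≤ θ) (hDB : FiniteMean DB) :
    (fun DB' : Distr ΘB =>
        ∫ v : ΘB, ∫ c : ΘS, max ((v : ℝ) - c) 0 ∂(DS : Measure ΘS) ∂(DB' : Measure ΘB))
      =ᵐ[(M : Measure (Distr ΘB))] fun DB' => efficientWelfare DS DB' := by
  filter_upwards [h.ae_finiteMean hDB] with DB' hDB'
  exact (efficientWelfare_swap hS0 DS hDB').symm

lemma integrable_efficientWelfare_buyer (h : Refines M DB) (hS0 : ∀ θ ∈ ΘS, 0 ≤ θ)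
    (hDB : FiniteMean DB) :
    Integrable (fun DB' => efficientWelfare DS DB') (M : Measure (Distr ΘB)) :=
  (h.integrable_integral (integrable_integral_gain hS0 DS hDB)).congr
    (h.ae_efficientWelfare_swap hS0 hDB)

lemma integral_efficientWelfare_buyer (h : Refines M DB) (hS0 : ∀ θ ∈ ΘS, 0 ≤ θ)
    (hDB : FiniteMean DB) :
    ∫ DB', efficientWelfare DS DB' ∂(M : Measure (Distr ΘB)) = efficientWelfare DS DB := by
  rw [← integral_congr_ae (h.ae_efficientWelfare_swap hS0 hDB),
    h.integral_integral (integrable_integral_gain hS0 DS hDB), efficientWelfare_swap hS0 DS hDB]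

end Refines

end Welfare

lemma IsLexMax.eq_of_le {α : Type*} {f g : α → ℝ} {s : Set α} {x y : α} (h : IsLexMax f g s x)
    (hy : y ∈ s) (hf : f x ≤ f y) (hg : g x ≤ g y) : f y = f x ∧ g y = g x := by
  have hf' : f y = f x := (h.2.1 y hy).antisymm hf
  exact ⟨hf', (h.2.2 y hy hf').antisymm hg⟩

namespace Protocol

variable {P : Protocol ΘS ΘB} {DS : Distr ΘS} {DB : Distr ΘB} {t : ℕ}

lemma payoff_succ_of_odd (ht : Odd (t + 1)) (i : Agent) (DS : Distr ΘS) (DB : Distr ΘB) :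
    P.payoff (t + 1) i DS DB = P.expB t i DS (P.msgB (t + 1) DS DB) := by
  rw [payoff, if_pos ht, expB]

lemma payoff_succ_of_even (ht : Even (t + 1)) (i : Agent) (DS : Distr ΘS) (DB : Distr ΘB) :
    P.payoff (t + 1) i DS DB = P.expS t i DB (P.msgS (t + 1) DS DB) := by
  rw [payoff, if_neg (Nat.not_odd_iff_even.2 ht), expS]

lemma payoff_zero_pointMass (i : Agent) (c : ΘS) (DB : Distr ΘB) :
    P.payoff 0 i (pointMass c) DB = expUtility i (P.price c DB) c DB :=
  integral_dirac (fun θ : ΘS => expUtility i (P.price θ DB) θ DB) c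

lemma payoff_zero_eq_integral_pointMass (i : Agent) (DS : Distr ΘS) (DB : Distr ΘB) :
    P.payoff 0 i DS DB = ∫ c, P.payoff 0 i (pointMass c) DB ∂(DS : Measure ΘS) :=
  integral_congr_ae (ae_of_all _ fun c => (payoff_zero_pointMass i c DB).symm)

/-- At this state, more than `t` rounds are of no use. -/
def IsStable (P : Protocol ΘS ΘB) (t : ℕ) (DS : Distr ΘS) (DB : Distr ΘB) : Prop :=
  ∀ n, t ≤ n → ∀ i, P.payoff n i DS DB = P.payoff t i DS DB

namespace IsEquilibrium

lemma isOptimalPrice (hP : P.IsEquilibrium) (c : ΘS) (hDB : FiniteMean DB) :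
    IsOptimalPrice (DB : Measure ΘB) c (P.price c DB) := by
  simpa only [IsOptimalPrice, expUtility_seller, expUtility_buyer] using hP.price_opt c DB hDB

lemma payoff_le_succ (hP : P.IsEquilibrium) (t : ℕ) (i : Agent) (DS : Distr ΘS)
    (hDB : FiniteMean DB) : P.payoff t i DS DB ≤ P.payoff (t + 1) i DS DB := by
  rcases Nat.even_or_odd (t + 1) with ht | ht
  · rw [payoff_succ_of_even ht]
    exact (hP.msgS_opt t ht DS DB hDB).1.2 i
  · rw [payoff_succ_of_odd ht]
    exact (hP.msgB_opt t ht DS DB hDB).1.2 i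

lemma payoff_mono (hP : P.IsEquilibrium) (i : Agent) (DS : Distr ΘS) (hDB : FiniteMean DB) :
    Monotone fun t => P.payoff t i DS DB :=
  monotone_nat_of_le_succ fun t => hP.payoff_le_succ t i DS hDB

lemma expUtility_nonneg (hP : P.IsEquilibrium) (hS0 : ∀ θ ∈ ΘS, 0 ≤ θ) (i : Agent) (c : ΘS)
    (hDB : FiniteMean DB) : 0 ≤ expUtility i (P.price c DB) c DB := by
  cases i
  · rw [expUtility_seller]
    exact (hP.isOptimalPrice c hDB).profit_nonneg (hS0 c c.2)
  · rw [expUtility_buyer]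
    exact surplus_nonneg

lemma payoff_nonneg (hP : P.IsEquilibrium) (hS0 : ∀ θ ∈ ΘS, 0 ≤ θ) (t : ℕ) (i : Agent)
    (DS : Distr ΘS) (hDB : FiniteMean DB) : 0 ≤ P.payoff t i DS DB :=
  le_trans (integral_nonneg fun c => hP.expUtility_nonneg hS0 i c hDB)
    (hP.payoff_mono i DS hDB (Nat.zero_le t))

lemma payoff_zero_add_le (hP : P.IsEquilibrium) (hS0 : ∀ θ ∈ ΘS, 0 ≤ θ) (DS : Distr ΘS)
    (hDB : FiniteMean DB) :
    P.payoff 0 .S DS DB + P.payoff 0 .B DS DB ≤ efficientWelfare DS DB := by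
  refine integral_add_le_of_add_le (fun c => hP.expUtility_nonneg hS0 .S c hDB)
    (fun c => hP.expUtility_nonneg hS0 .B c hDB) (fun c => ?_) (integrable_surplus hS0 DS hDB)
  rw [expUtility_seller, expUtility_buyer]
  exact profit_add_surplus_le hDB

lemma payoff_add_le (hP : P.IsEquilibrium) (hS0 : ∀ θ ∈ ΘS, 0 ≤ θ) (t : ℕ) (DS : Distr ΘS)
    (hDB : FiniteMean DB) :
    P.payoff t .S DS DB + P.payoff t .B DS DB ≤ efficientWelfare DS DB := by
  induction t generalizing DS DB with
  | zero => exact hP.payoff_zero_add_le hS0 DS hDB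
  | succ t ih =>
    rcases Nat.even_or_odd (t + 1) with ht | ht
    · have hM := P.msgS_refines (t + 1) DS DB
      have hi := hP.integrableS t ht DS DB hDB _ hM
      rw [payoff_succ_of_even ht, payoff_succ_of_even ht, expS, expS,
        ← integral_add (hi .S) (hi .B), ← hM.integral_efficientWelfare_seller hS0 hDB]
      exact integral_mono ((hi .S).add (hi .B)) (hM.integrable_efficientWelfare_seller hS0 hDB)
        fun DS' => ih DS' hDB
    · have hM := P.msgB_refines (t + 1) DS DB
      have hi := hP.integrableB t ht DS DB hDB _ hM
      rw [payoff_succ_of_odd ht, payoff_succ_of_odd ht, expB, expB,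
        ← integral_add (hi .S) (hi .B), ← hM.integral_efficientWelfare_buyer hS0 hDB]
      refine integral_mono_ae ((hi .S).add (hi .B))
        (hM.integrable_efficientWelfare_buyer hS0 hDB) ?_
      filter_upwards [hM.ae_finiteMean hDB] with DB' hDB'
      exact ih DS hDB'

lemma payoff_zero_seller_le_expB (hP : P.IsEquilibrium) (c : ΘS) (hDB : FiniteMean DB)
    {M : ProbabilityMeasure (Distr ΘB)} (hM : Refines M DB) :
    P.payoff 0 .S (pointMass c) DB ≤ P.expB 0 .S (pointMass c) M := by
  have hu := integrable_utility hDB .S (P.price c DB) c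
  rw [payoff_zero_pointMass, expUtility, ← hM.integral_integral hu, expB]
  refine integral_mono_ae (hM.integrable_integral hu)
    (hP.integrableB 0 odd_one _ DB hDB M hM .S) ?_
  filter_upwards [hM.ae_finiteMean hDB] with DB' hDB'
  rw [payoff_zero_pointMass]
  exact (hP.price_opt c DB' hDB').2.1 _ (hP.price_opt c DB hDB).1

lemma expB_zero_buyer_le (hP : P.IsEquilibrium) (c : ΘS) (hDB : FiniteMean DB)
    {M : ProbabilityMeasure (Distr ΘB)} (hM : Refines M DB) :
    P.expB 0 .B (pointMass c) M ≤ P.payoff 1 .B (pointMass c) DB := by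
  rcases le_total (P.expB 0 .B (pointMass c) M) (P.payoff 0 .B (pointMass c) DB) with h | h
  · exact h.trans (hP.payoff_le_succ 0 .B _ hDB)
  · rw [payoff_succ_of_odd odd_one]
    refine (hP.msgB_opt 0 odd_one (pointMass c) DB hDB).2.1 M ⟨hM, fun i => ?_⟩
    cases i
    · exact hP.payoff_zero_seller_le_expB c hDB hM
    · exact h

lemma efficient_pointMass_of_payoff_one_eq (hP : P.IsEquilibrium) (hS0 : ∀ θ ∈ ΘS, 0 ≤ θ) (c : ΘS)
    (hDB : FiniteMean DB)
    (h : P.payoff 0 .B (pointMass c) DB = P.payoff 1 .B (pointMass c) DB) :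
    P.payoff 0 .S (pointMass c) DB + P.payoff 0 .B (pointMass c) DB
      = surplus (DB : Measure ΘB) c := by
  have hB (DB' : Distr ΘB) : P.payoff 0 .B (pointMass c) DB'
      = surplus (DB' : Measure ΘB) (P.price c DB') := by
    rw [payoff_zero_pointMass, expUtility_buyer]
  have hint := fun M hM => hP.integrableB 0 odd_one (pointMass c) DB hDB M hM .B
  have hmax := fun M (hM : Refines M DB) => (hP.expB_zero_buyer_le c hDB hM).trans h.ge
  simp only [expB, hB] at hint hmax
  rw [hB, payoff_zero_pointMass, expUtility_seller]
  exact profit_add_surplus_eq_of_forall_refines_le (hS0 c c.2) (fun _ => hP.isOptimalPrice c)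
    hDB hint hmax

lemma expB_eq_payoff_succ (hP : P.IsEquilibrium) (ht : Odd (t + 1)) (hDB : FiniteMean DB)
    {M : ProbabilityMeasure (Distr ΘB)} (hM : Refines M DB)
    (h : ∀ i, P.payoff (t + 1) i DS DB ≤ P.expB t i DS M) (i : Agent) :
    P.expB t i DS M = P.payoff (t + 1) i DS DB := by
  have hvol : M ∈ P.VRB t DS DB := ⟨hM, fun i => (hP.payoff_le_succ t i DS hDB).trans (h i)⟩
  simp only [payoff_succ_of_odd ht] at h ⊢
  obtain ⟨hB, hS⟩ := (hP.msgB_opt t ht DS DB hDB).eq_of_le hvol (h .B) (h .S)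
  cases i
  exacts [hS, hB]

lemma expS_eq_payoff_succ (hP : P.IsEquilibrium) (ht : Even (t + 1)) (hDB : FiniteMean DB)
    {M : ProbabilityMeasure (Distr ΘS)} (hM : Refines M DS)
    (h : ∀ i, P.payoff (t + 1) i DS DB ≤ P.expS t i DB M) (i : Agent) :
    P.expS t i DB M = P.payoff (t + 1) i DS DB := by
  have hvol : M ∈ P.VRS t DS DB := ⟨hM, fun i => (hP.payoff_le_succ t i DS hDB).trans (h i)⟩
  simp only [payoff_succ_of_even ht] at h ⊢
  obtain ⟨hS, hB⟩ := (hP.msgS_opt t ht DS DB hDB).eq_of_le hvol (h .S) (h .B)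
  cases i
  exacts [hS, hB]

lemma integrable_payoff_pointMass (hP : P.IsEquilibrium) (ht : Even (t + 1)) (i : Agent)
    (DS : Distr ΘS) (hDB : FiniteMean DB) :
    Integrable (fun c => P.payoff t i (pointMass c) DB) (DS : Measure ΘS) :=
  Integrable.comp_measurable
    (hP.integrableS t ht DS DB hDB _ (refines_fullRevelation DS) i) measurable_pointMass

lemma expS_fullRevelation (hP : P.IsEquilibrium) (ht : Even (t + 1)) (i : Agent)
    (DS : Distr ΘS) (hDB : FiniteMean DB) :
    P.expS t i DB (fullRevelation DS) = ∫ c, P.payoff t i (pointMass c) DB ∂(DS : Measure ΘS) :=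
  integral_map measurable_pointMass.aemeasurable
    (hP.integrableS t ht DS DB hDB _ (refines_fullRevelation DS) i).aestronglyMeasurable

lemma ae_payoff_zero_pointMass_eq (hP : P.IsEquilibrium) (hS0 : ∀ θ ∈ ΘS, 0 ≤ θ)
    (hDB : FiniteMean DB) (h : ∀ i, P.payoff 2 i DS DB = P.payoff 0 i DS DB) (i : Agent) :
    (fun c => P.payoff 0 i (pointMass c) DB) =ᵐ[(DS : Measure ΘS)]
      fun c => P.payoff 1 i (pointMass c) DB := by
  have hle (i c) : P.payoff 0 i (pointMass c) DB ≤ P.payoff 1 i (pointMass c) DB :=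
    hP.payoff_le_succ 0 i _ hDB
  have h0 (i c) : 0 ≤ P.payoff 0 i (pointMass c) DB := hP.payoff_nonneg hS0 0 i _ hDB
  have hi (i) := hP.integrable_payoff_pointMass even_two i DS hDB
  refine ae_eq_of_integral_eq_of_nonneg (h0 i) (hle i) (hi i) ?_
  rw [← payoff_zero_eq_integral_pointMass, ← hP.expS_fullRevelation even_two i DS hDB, ← h]
  refine (hP.expS_eq_payoff_succ even_two hDB (refines_fullRevelation DS) (fun i => ?_) i).symm
  rw [h, payoff_zero_eq_integral_pointMass, hP.expS_fullRevelation even_two i DS hDB]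
  exact integral_mono_of_nonneg (ae_of_all _ (h0 i)) (hi i) (ae_of_all _ (hle i))

lemma efficient_of_payoff_two_eq (hP : P.IsEquilibrium) (hS0 : ∀ θ ∈ ΘS, 0 ≤ θ)
    (hDB : FiniteMean DB) (h : ∀ i, P.payoff 2 i DS DB = P.payoff 0 i DS DB) :
    P.payoff 0 .S DS DB + P.payoff 0 .B DS DB = efficientWelfare DS DB := by
  have hae := hP.ae_payoff_zero_pointMass_eq hS0 hDB h
  have hi (i) : Integrable (fun c => P.payoff 0 i (pointMass c) DB) (DS : Measure ΘS) :=
    (hP.integrable_payoff_pointMass even_two i DS hDB).congr (hae i).symm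
  rw [payoff_zero_eq_integral_pointMass, payoff_zero_eq_integral_pointMass,
    ← integral_add (hi .S) (hi .B)]
  refine integral_congr_ae ?_
  filter_upwards [hae .B] with c hc
  exact hP.efficient_pointMass_of_payoff_one_eq hS0 c hDB hc

lemma isStable_of_payoff_add_two_mul_eq (hP : P.IsEquilibrium) (hDB : FiniteMean DB)
    (h : ∀ k i, P.payoff (t + 2 * k) i DS DB = P.payoff t i DS DB) : P.IsStable t DS DB :=
  fun n hn i =>
    ((hP.payoff_mono i DS hDB (show n ≤ t + 2 * (n - t) by lia)).trans (h _ i).le).antisymm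
      (hP.payoff_mono i DS hDB hn)

lemma ae_isStable_of_integral_eq (hP : P.IsEquilibrium) {α : Type*} [MeasurableSpace α]
    {μ : Measure α} {S : α → Distr ΘS} {B : α → Distr ΘB} (hB : ∀ᵐ x ∂μ, FiniteMean (B x))
    (hint : ∀ k i, Integrable (fun x => P.payoff (t + 2 * k) i (S x) (B x)) μ)
    (h : ∀ k i, ∫ x, P.payoff (t + 2 * k) i (S x) (B x) ∂μ = ∫ x, P.payoff t i (S x) (B x) ∂μ) :
    ∀ᵐ x ∂μ, P.IsStable t (S x) (B x) := by
  have hae (i : Agent) : ∀ᵐ x ∂μ, ∀ k,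
      P.payoff t i (S x) (B x) = P.payoff (t + 2 * k) i (S x) (B x) := by
    refine ae_all_iff.2 fun k => (integral_eq_iff_of_ae_le (hint 0 i) (hint k i) ?_).1 (h k i).symm
    filter_upwards [hB] with x hx
    exact hP.payoff_mono i (S x) hx (Nat.le_add_right _ _)
  filter_upwards [hB, hae .S, hae .B] with x hx hxS hxB
  refine hP.isStable_of_payoff_add_two_mul_eq hx fun k i => ?_
  cases i
  exacts [(hxS k).symm, (hxB k).symm]

lemma ae_isStable_msgB (hP : P.IsEquilibrium) (ht : Odd (t + 1)) (hDB : FiniteMean DB)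
    (h : P.IsStable (t + 1) DS DB) :
    ∀ᵐ DB' ∂(P.msgB (t + 1) DS DB : Measure (Distr ΘB)), P.IsStable t DS DB' := by
  have hM := P.msgB_refines (t + 1) DS DB
  have hodd (k : ℕ) : Odd (t + 2 * k + 1) := by
    rw [add_right_comm]
    exact ht.add_even (even_two_mul k)
  have hint (k) := hP.integrableB _ (hodd k) DS DB hDB _ hM
  have hk (k i) : P.payoff (t + 2 * k + 1) i DS DB = P.expB t i DS (P.msgB (t + 1) DS DB) :=
    (h _ (by lia) i).trans (payoff_succ_of_odd ht i DS DB)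
  refine hP.ae_isStable_of_integral_eq (hM.ae_finiteMean hDB) hint fun k i => ?_
  refine (hP.expB_eq_payoff_succ (hodd k) hDB hM (fun i => ?_) i).trans (hk k i)
  rw [hk]
  refine integral_mono_ae (hint 0 i) (hint k i) ?_
  filter_upwards [hM.ae_finiteMean hDB] with DB' hDB'
  exact hP.payoff_mono i DS hDB' (Nat.le_add_right _ _)

lemma ae_isStable_msgS (hP : P.IsEquilibrium) (ht : Even (t + 1)) (hDB : FiniteMean DB)
    (h : P.IsStable (t + 1) DS DB) :
    ∀ᵐ DS' ∂(P.msgS (t + 1) DS DB : Measure (Distr ΘS)), P.IsStable t DS' DB := by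
  have hM := P.msgS_refines (t + 1) DS DB
  have heven (k : ℕ) : Even (t + 2 * k + 1) := by
    rw [add_right_comm]
    exact ht.add (even_two_mul k)
  have hint (k) := hP.integrableS _ (heven k) DS DB hDB _ hM
  have hk (k i) : P.payoff (t + 2 * k + 1) i DS DB = P.expS t i DB (P.msgS (t + 1) DS DB) :=
    (h _ (by lia) i).trans (payoff_succ_of_even ht i DS DB)
  refine hP.ae_isStable_of_integral_eq (ae_of_all _ fun _ => hDB) hint fun k i => ?_
  refine (hP.expS_eq_payoff_succ (heven k) hDB hM (fun i => ?_) i).trans (hk k i)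
  rw [hk]
  exact integral_mono (hint 0 i) (hint k i)
    fun DS' => hP.payoff_mono i DS' hDB (Nat.le_add_right _ _)

theorem efficient_of_isStable (hP : P.IsEquilibrium) (hS0 : ∀ θ ∈ ΘS, 0 ≤ θ)
    (hDB : FiniteMean DB) (h : P.IsStable t DS DB) :
    P.payoff t .S DS DB + P.payoff t .B DS DB = efficientWelfare DS DB := by
  induction t generalizing DS DB with
  | zero => exact hP.efficient_of_payoff_two_eq hS0 hDB (h 2 (Nat.zero_le _))
  | succ t ih =>
    rcases Nat.even_or_odd (t + 1) with ht | ht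
    · have hM := P.msgS_refines (t + 1) DS DB
      have hi := hP.integrableS t ht DS DB hDB _ hM
      rw [payoff_succ_of_even ht, payoff_succ_of_even ht, expS, expS,
        ← integral_add (hi .S) (hi .B), ← hM.integral_efficientWelfare_seller hS0 hDB]
      refine integral_congr_ae ?_
      filter_upwards [hP.ae_isStable_msgS ht hDB h] with DS' hstable
      exact ih hDB hstable
    · have hM := P.msgB_refines (t + 1) DS DB
      have hi := hP.integrableB t ht DS DB hDB _ hM
      rw [payoff_succ_of_odd ht, payoff_succ_of_odd ht, expB, expB,
        ← integral_add (hi .S) (hi .B), ← hM.integral_efficientWelfare_buyer hS0 hDB]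
      refine integral_congr_ae ?_
      filter_upwards [hP.ae_isStable_msgB ht hDB h, hM.ae_finiteMean hDB] with DB' hstable hDB'
      exact ih hDB' hstable

lemma payoff_le_efficientWelfare (hP : P.IsEquilibrium) (hS0 : ∀ θ ∈ ΘS, 0 ≤ θ) (t : ℕ)
    (i : Agent) (DS : Distr ΘS) (hDB : FiniteMean DB) :
    P.payoff t i DS DB ≤ efficientWelfare DS DB := by
  refine le_trans ?_ (hP.payoff_add_le hS0 t DS hDB)
  cases i
  · exact le_add_of_nonneg_right (hP.payoff_nonneg hS0 t .B DS hDB)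
  · exact le_add_of_nonneg_left (hP.payoff_nonneg hS0 t .S DS hDB)

lemma tendsto_payoff (hP : P.IsEquilibrium) (hS0 : ∀ θ ∈ ΘS, 0 ≤ θ) (i : Agent) (DS : Distr ΘS)
    (hDB : FiniteMean DB) :
    Tendsto (fun n => P.payoff n i DS DB) atTop (𝓝 (P.payoffE ⊤ i DS DB)) :=
  tendsto_nhds_limUnder ⟨_, tendsto_atTop_ciSup (hP.payoff_mono i DS hDB)
    ⟨efficientWelfare DS DB, Set.forall_mem_range.2
      fun n => hP.payoff_le_efficientWelfare hS0 n i DS hDB⟩⟩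

lemma payoff_le_payoffE_top (hP : P.IsEquilibrium) (hS0 : ∀ θ ∈ ΘS, 0 ≤ θ) (t : ℕ) (i : Agent)
    (DS : Distr ΘS) (hDB : FiniteMean DB) : P.payoff t i DS DB ≤ P.payoffE ⊤ i DS DB :=
  (hP.payoff_mono i DS hDB).ge_of_tendsto (hP.tendsto_payoff hS0 i DS hDB) t

lemma isStable_of_messageComplexity_eq (hP : P.IsEquilibrium) (hS0 : ∀ θ ∈ ΘS, 0 ≤ θ)
    (hDB : FiniteMean DB) (ht : P.messageComplexity DS DB = t) : P.IsStable t DS DB := by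
  have hmem : P.messageComplexity DS DB ∈ {n : ℕ∞ | P.payoffE n .S DS DB + P.payoffE n .B DS DB
      = P.payoffE ⊤ .S DS DB + P.payoffE ⊤ .B DS DB} := csInf_mem ⟨⊤, rfl⟩
  rw [ht] at hmem
  have hsum : P.payoff t .S DS DB + P.payoff t .B DS DB
      = P.payoffE ⊤ .S DS DB + P.payoffE ⊤ .B DS DB := hmem
  intro n hn i
  have hmono (i) : P.payoff t i DS DB ≤ P.payoff n i DS DB := hP.payoff_mono i DS hDB hn
  have htop (i) := hP.payoff_le_payoffE_top hS0 n i DS hDB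
  cases i <;> linarith [hmono .S, hmono .B, htop .S, htop .B]

end IsEquilibrium

end Protocol

end BilateralTrade

open BilateralTrade in
theorem theorem1_general (ΘS ΘB : Set ℝ) (hS0 : ∀ θ ∈ ΘS, 0 ≤ θ)
    (P : Protocol ΘS ΘB) (hP : P.IsEquilibrium)
    (DS : Distr ΘS) (DB : Distr ΘB) (hDB : FiniteMean DB)
    (t : ℕ) (ht : P.messageComplexity DS DB = t) :
    P.payoff t .S DS DB + P.payoff t .B DS DB = efficientWelfare DS DB :=
  hP.efficient_of_isStable hS0 hDB (hP.isStable_of_messageComplexity_eq hS0 hDB ht)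

open BilateralTrade in
theorem theorem1 (ΘS ΘB : Set ℝ) (hΘS : MeasurableSet ΘS) (hΘB : MeasurableSet ΘB)
    (hS0 : ∀ θ ∈ ΘS, 0 ≤ θ) (hB0 : ∀ θ ∈ ΘB, 0 ≤ θ)
    (P : Protocol ΘS ΘB) (hP : P.IsEquilibrium)
    (DS : Distr ΘS) (DB : Distr ΘB) (hDB : FiniteMean DB)
    (t : ℕ) (ht : P.messageComplexity DS DB = t) :
    P.payoff t .S DS DB + P.payoff t .B DS DB = efficientWelfare DS DB :=
  theorem1_general ΘS ΘB hS0 P hP DS DB hDB t ht
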